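/- Let $m=(m_0,m_1,\dots)$ be a sequence of integers $m_j\ge 2$, let $G_m=\prod_{j\ge 0}\mathbb{Z}/m_j\mathbb{Z}$ with its normalized Haar measure $\mu$ (the product of the uniform measures), and put $M_0=1$, $M_{k+1}=m_kM_k$. Let $\mathcal F_n$ be the $\sigma$-algebra generated by the sets $I_n(x)=\{y\in G_m: y_0=x_0,\dots,y_{n-1}=x_{n-1}\}$, $x\in G_m$. For $n=\sum_k n_kM_k$ with $0\le n_k<m_k$ let $\psi_n(x)=\prod_k \exp(2\pi i x_k/m_k)^{n_k}$ be the Vilenkin functions. For $0<p\le 1$ the space $H_p(G_m)$ consists of the complex martingales $f=(f_n)_{n\in\mathbb N}$ with respect to $(\mathcal F_n)$ with $\|f\|_{H_p}:=\big(\int_{G_m}(\sup_n|f_n|)^p\,d\mu\big)^{1/p}<\infty$. For a martingale $f$ put $\widehat f(i)=\lim_{k\to\infty}\int_{G_m} f_k\overline{\psi_i}\,d\mu$ and $S_nf=\sum_{i=0}^{n-1}\widehat f(i)\psi_i$. An integrable function $g$, with partial sums $S_ng=\sum_{i=0}^{n-1}\big(\int_{G_m} g\overline{\psi_i}\,d\mu\big)\psi_i$,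 is identified with the martingale $(S_{M_j}g)_{j\in\mathbb N}$. Finally put $$\omega\Big(\frac1{M_k},f\Big)_{H_p}=\|f-S_{M_k}f\|_{H_p}.$$ Theorem 2. Let $0<p\le 1$ and, if $p<1$, assume that $G_m$ is a bounded Vilenkin group, that is, $m_j\le B$ for all $j$ and some integer $B$. Then there is a constant $c>0$, depending only on $p$ and (if $p<1$) on the bound $B$, such that for all $f\in H_p(G_m)$ and all $k\ge 0$ and $n$ with $M_k<n\le M_{k+1}$ $$\|S_nf-f\|_{H_p(G_m)}\le c\,n^{1/p-1}(\log n)^{[p]}\,\omega\Big(\frac1{M_k},f\Big)_{H_p(G_m)},$$ where $[p]$ is the integer part of $p$. -/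

import Mathlib

open MeasureTheory ProbabilityTheory Filter
open scoped ENNReal ComplexConjugate

namespace Vilenkin

/-- The Vilenkin group `G_m`: the complete direct product of the cyclic groups `ZMod (m j)`. Each
factor carries the discrete topology and sigma-algebra, and the product carries the product ones. -/
abbrev Group (m : ℕ → ℕ) : Type := (j : ℕ) → ZMod (m j)

/-- The product of the uniform probability measures on the factors, that is, the normalized Haar
measure of `G_m`. -/
noncomputable def haar (m : ℕ → ℕ) [∀ j, NeZero (m j)] : Measure (Group m) :=
  Measure.infinitePi fun j => uniformOn (Set.univ : Set (ZMod (m j)))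

/-- The interval `I_n(x)` of all points whose first `n` coordinates agree with those of `x`. -/
def interval (m : ℕ → ℕ) (n : ℕ) (x : Group m) : Set (Group m) := {y | ∀ j < n, y j = x j}

theorem finite_range_interval (m : ℕ → ℕ) [∀ j, NeZero (m j)] (n : ℕ) :
    (Set.range (interval m n)).Finite := by
  classical
  let F : ((j : Fin n) → ZMod (m j)) → Set (Group m) := fun z => {y | ∀ j : Fin n, y j = z j}
  refine (Set.finite_range F).subset ?_
  rintro _ ⟨x, rfl⟩
  refine ⟨fun j => x j, ?_⟩
  ext y
  exact ⟨fun h j hj => h ⟨j, hj⟩, fun h j => h j j.2⟩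

theorem measurableSet_interval (m : ℕ → ℕ) (n : ℕ) (x : Group m) :
    MeasurableSet (interval m n x) := by
  have h : interval m n x = ⋂ j, ⋂ (_ : j < n), (fun y : Group m => y j) ⁻¹' {x j} := by
    ext y
    simp [interval]
  rw [h]
  exact MeasurableSet.iInter fun j => MeasurableSet.iInter fun _ =>
    measurable_pi_apply j (measurableSet_singleton (x j))

/-- The filtration whose `n`-th sigma-algebra is generated by the intervals `I_n(x)`. -/
def filtration (m : ℕ → ℕ) [∀ j, NeZero (m j)] :
    Filtration ℕ (inferInstance : MeasurableSpace (Group m)) where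
  seq n := MeasurableSpace.generateFrom (Set.range (interval m n))
  mono' := by
    intro i j hij
    refine MeasurableSpace.generateFrom_le ?_
    rintro _ ⟨x, rfl⟩
    have h : interval m i x = ⋃₀ {s ∈ Set.range (interval m j) | s ⊆ interval m i x} := by
      ext y
      constructor
      · intro hy
        refine ⟨interval m j y, ⟨⟨y, rfl⟩, ?_⟩, fun l _ => rfl⟩
        intro z hz l hl
        exact (hz l (hl.trans_le hij)).trans (hy l hl)
      · rintro ⟨s, ⟨_, hs⟩, hy⟩
        exact hs hy
    rw [h]
    exact MeasurableSet.sUnion ((finite_range_interval m j).subset fun s hs => hs.1).countable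
      fun s hs => MeasurableSpace.measurableSet_generateFrom hs.1
  le' n := by
    refine MeasurableSpace.generateFrom_le ?_
    rintro _ ⟨x, rfl⟩
    exact measurableSet_interval m n x

/-- The generalized powers `M_0 = 1`, `M_{k+1} = m_k M_k`. -/
def M (m : ℕ → ℕ) : ℕ → ℕ
  | 0 => 1
  | k + 1 => m k * M m k

/-- The `k`-th digit `n_k` of `n` in the expansion `n = ∑ n_k M_k`, `0 ≤ n_k < m_k`. -/
def digit (m : ℕ → ℕ) (n k : ℕ) : ℕ := n / M m k % m k

/-- The generalized Rademacher function `r_k(x) = exp (2 π i x_k / m_k)`. -/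
noncomputable def rademacher (m : ℕ → ℕ) (k : ℕ) (x : Group m) : ℂ :=
  Complex.exp (2 * Real.pi * Complex.I * ((x k).val : ℂ) / (m k : ℂ))

/-- The Vilenkin function `ψ_n = ∏ r_k ^ n_k`. Only the factors with `k < n` are written: since
`n < M_n`, all digits `n_k` with `n ≤ k` vanish (`digit_eq_zero`). -/
noncomputable def psi (m : ℕ → ℕ) (n : ℕ) (x : Group m) : ℂ :=
  ∏ k ∈ Finset.range n, rademacher m k x ^ digit m n k

theorem digit_eq_zero (m : ℕ → ℕ) (hm : ∀ j, 2 ≤ m j) {n k : ℕ} (h : n ≤ k) :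
    digit m n k = 0 := by
  have hM : ∀ l, l < M m l := by
    intro l
    induction l with
    | zero => simp [M]
    | succ l ih =>
      have := Nat.mul_le_mul_right (M m l) (hm l)
      simp only [M]
      omega
  simp [digit, Nat.div_eq_of_lt (h.trans_lt (hM k))]

section

variable (m : ℕ → ℕ) [∀ j, NeZero (m j)]

/-- Vilenkin-Fourier coefficients of an integrable function. -/
noncomputable def coeff (g : Group m → ℂ) (i : ℕ) : ℂ :=
  ∫ x, g x * conj (psi m i x) ∂(haar m)

/-- Partial sums `S_n g` of the Vilenkin-Fourier series of an integrable function. -/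
noncomputable def partialSum (n : ℕ) (g : Group m → ℂ) (x : Group m) : ℂ :=
  ∑ i ∈ Finset.range n, coeff m g i * psi m i x

/-- The martingale `(S_{M_j} g)_j` obtained from an integrable function `g`. -/
noncomputable def toMartingale (g : Group m → ℂ) (j : ℕ) : Group m → ℂ :=
  partialSum m (M m j) g

/-- Vilenkin-Fourier coefficients of a martingale: `lim_k ∫ f_k conj(ψ_i)`. -/
noncomputable def martingaleCoeff (f : ℕ → Group m → ℂ) (i : ℕ) : ℂ :=
  limUnder atTop fun k => ∫ x, f k x * conj (psi m i x) ∂(haar m)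

/-- Partial sums `S_n f` of the Vilenkin-Fourier series of a martingale, as functions. -/
noncomputable def martingalePartialSum (n : ℕ) (f : ℕ → Group m → ℂ) (x : Group m) : ℂ :=
  ∑ i ∈ Finset.range n, martingaleCoeff m f i * psi m i x

/-- The maximal function `f^* = sup_n |f_n|`. -/
noncomputable def maximal (f : ℕ → Group m → ℂ) (x : Group m) : ℝ≥0∞ := ⨆ n, ‖f n x‖ₑ

/-- The quasinorm `‖f‖_{H_p} = ‖f^*‖_p` (possibly infinite). -/
noncomputable def hardyNorm (p : ℝ) (f : ℕ → Group m → ℂ) : ℝ≥0∞ :=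
  (∫⁻ x, maximal m f x ^ p ∂(haar m)) ^ (1 / p)

/-- Membership in the martingale Hardy space `H_p(G_m)`. -/
def MemHardy (p : ℝ) (f : ℕ → Group m → ℂ) : Prop :=
  Martingale f (filtration m) (haar m) ∧ hardyNorm m p f < ∞

/-- The modulus of continuity `ω(1/M_k, f)_{H_p} = ‖f - S_{M_k} f‖_{H_p}`. -/
noncomputable def modulus (p : ℝ) (k : ℕ) (f : ℕ → Group m → ℂ) : ℝ≥0∞ :=
  hardyNorm m p (f - toMartingale m (martingalePartialSum m (M m k) f))

end

end Vilenkin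

/-! Write `g = f - S_{M_k} f`. Levels `j ≤ k` of `S_n f - f` vanish, since `n > M_k`. At levels `j >
k` the difference equals `S_n g_{k+1} - g_j`, since `n ≤ M_{k+1}`. Hence its maximal function is at
most `|S_n g_{k+1}| + g^*`, and since `|g_{k+1}| ≤ g^*` it remains to bound `S_n` in `L^p` on
functions of the first `k + 1` coordinates (`hardyNorm_partialSum_sub_le`).

On the finite group of the first `K` coordinates `S_n` is convolution with the Dirichlet kernel
`D_n`, and subadditivity of `t ↦ t ^ p` gives the operator bound `M_K ^ (1 - p) ∫ |D_n| ^ p`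
(`lintegral_partialSum_rpow_le`).

The kernel is estimated by removing leading digits of `n`: `D_{s M_k + i}` is a cyclic Dirichlet
kernel in `x_k` times `D_{M_k} = M_k 1_{I_k(0)}`, plus a unimodular multiple of `D_i`. For `p = 1`
each digit `s` costs `O(log (s + 1))`, uniformly in `m_k`, and the logarithms add up to `O(log n)`.
For `p < 1` the costs `B M_k ^ (p - 1)` form a convergent series, and `M_{k+1} ≤ B n` turns the
factor `M_{k+1} ^ (1 - p)` into `n ^ (1 - p)`. Taking the `1 / p`-th power gives the rate. -/

namespace Vilenkin

/-! ### Digits, Vilenkin functions and Dirichlet kernels -/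

section Characters

variable (m : ℕ → ℕ)

theorem M_dvd_M {j k : ℕ} (h : j ≤ k) : M m j ∣ M m k := by
  induction k, h using Nat.le_induction with
  | base => exact dvd_rfl
  | succ k _ ih => exact ih.mul_left (m k)

theorem M_eq_prod (k : ℕ) : M m k = ∏ j ∈ Finset.range k, m j := by
  induction k with
  | zero => simp [M]
  | succ k ih => rw [Finset.prod_range_succ, ← ih, M, mul_comm]

theorem two_pow_le_M (hm : ∀ j, 2 ≤ m j) (k : ℕ) : 2 ^ k ≤ M m k := by
  induction k with
  | zero => simp [M]
  | succ k ih =>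
    rw [pow_succ, mul_comm]
    exact Nat.mul_le_mul (hm k) ih

theorem lt_M (hm : ∀ j, 2 ≤ m j) (k : ℕ) : k < M m k :=
  Nat.lt_two_pow_self.trans_le (two_pow_le_M m hm k)

theorem mul_M_add_lt {a i k : ℕ} (ha : a < m k) (hi : i < M m k) :
    a * M m k + i < M m (k + 1) := by
  have := Nat.mul_le_mul_right (M m k) (Nat.succ_le_of_lt ha)
  rw [Nat.succ_mul] at this
  rw [M]
  omega

variable [∀ j, NeZero (m j)]

theorem M_pos (k : ℕ) : 0 < M m k := by
  induction k with
  | zero => simp [M]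
  | succ k ih => exact Nat.mul_pos (NeZero.pos (m k)) ih

theorem M_mono : Monotone (M m) := fun _ k h => Nat.le_of_dvd (M_pos m k) (M_dvd_M m h)

theorem digit_eq_zero_of_lt {n k j : ℕ} (h : n < M m k) (hj : k ≤ j) : digit m n j = 0 := by
  simp [digit, Nat.div_eq_of_lt (h.trans_le (M_mono m hj))]

/-- The extra or missing factors have digit zero. This frees the product from the range `k < n` and
ties it to the number of coordinates. -/
theorem psi_eq_prod (hm : ∀ j, 2 ≤ m j) {n K : ℕ} (h : n < M m K) (x : Group m) :
    psi m n x = ∏ k ∈ Finset.range K, rademacher m k x ^ digit m n k := by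
  rcases le_total n K with hK | hK
  · refine Finset.prod_subset (Finset.range_mono hK) fun k _ hk => ?_
    rw [digit_eq_zero m hm (by simpa using hk), pow_zero]
  · refine (Finset.prod_subset (Finset.range_mono hK) fun k _ hk => ?_).symm
    rw [digit_eq_zero_of_lt m h (by simpa using hk), pow_zero]

theorem rademacher_eq (k : ℕ) (x : Group m) : rademacher m k x = ZMod.stdAddChar (x k) := by
  rw [ZMod.stdAddChar_apply, ZMod.toCircle_apply]
  rfl

theorem rademacher_sub (k : ℕ) (x y : Group m) :
    rademacher m k (x - y) = rademacher m k x * conj (rademacher m k y) := by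
  simp only [rademacher_eq, Pi.sub_apply]
  rw [sub_eq_add_neg, AddChar.map_add_eq_mul, AddChar.map_neg_eq_conj]

theorem psi_sub (n : ℕ) (x y : Group m) : psi m n (x - y) = psi m n x * conj (psi m n y) := by
  simp only [psi, rademacher_sub, map_prod, map_pow, mul_pow, Finset.prod_mul_distrib]

theorem digit_mul_add_of_lt {a i j k : ℕ} (hj : j < k) :
    digit m (a * M m k + i) j = digit m i j := by
  obtain ⟨q, hq⟩ := M_dvd_M m (Nat.succ_le_of_lt hj)
  have : a * M m k + i = i + M m j * (m j * (a * q)) := by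
    rw [hq, M]; ring
  rw [digit, digit, this, Nat.add_mul_div_left _ _ (M_pos m j), Nat.add_mul_mod_self_left]

theorem digit_mul_add_self {a i k : ℕ} (ha : a < m k) (hi : i < M m k) :
    digit m (a * M m k + i) k = a := by
  rw [digit, add_comm, Nat.add_mul_div_right _ _ (M_pos m k), Nat.div_eq_of_lt hi, zero_add,
    Nat.mod_eq_of_lt ha]

theorem psi_mul_add (hm : ∀ j, 2 ≤ m j) {a i k : ℕ} (ha : a < m k) (hi : i < M m k)
    (x : Group m) :
    psi m (a * M m k + i) x = rademacher m k x ^ a * psi m i x := by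
  rw [psi_eq_prod m hm (mul_M_add_lt m ha hi), Finset.prod_range_succ,
    digit_mul_add_self m ha hi, psi_eq_prod m hm hi, mul_comm]
  congr 1
  exact Finset.prod_congr rfl fun j hj => by
    rw [digit_mul_add_of_lt m (Finset.mem_range.1 hj)]

theorem dependsOn_psi (hm : ∀ j, 2 ≤ m j) {n K : ℕ} (h : n < M m K) :
    DependsOn (psi m n) (Set.Iio K) := by
  intro x y hxy
  rw [psi_eq_prod m hm h, psi_eq_prod m hm h]
  refine Finset.prod_congr rfl fun j hj => ?_
  rw [rademacher_eq, rademacher_eq, hxy j (Finset.mem_range.1 hj)]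

/-- The Dirichlet kernel `D_n = ∑_{i < n} ψ_i`. -/
noncomputable def dirichlet (n : ℕ) (x : Group m) : ℂ := ∑ i ∈ Finset.range n, psi m i x

/-- The Dirichlet kernel `∑_{a < s} exp (2 π i a t / N)` of the cyclic group `ZMod N`. -/
noncomputable def cyclicDirichlet (N : ℕ) [NeZero N] (s : ℕ) (t : ZMod N) : ℂ :=
  ∑ a ∈ Finset.range s, ZMod.stdAddChar t ^ a

theorem dependsOn_dirichlet (hm : ∀ j, 2 ≤ m j) {n K : ℕ} (h : n ≤ M m K) :
    DependsOn (dirichlet m n) (Set.Iio K) := fun _ _ hxy =>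
  Finset.sum_congr rfl fun _ hi =>
    dependsOn_psi m hm ((Finset.mem_range.1 hi).trans_le h) hxy

theorem dirichlet_mul_M (hm : ∀ j, 2 ≤ m j) {s k : ℕ} (hs : s ≤ m k) (x : Group m) :
    dirichlet m (s * M m k) x = cyclicDirichlet (m k) s (x k) * dirichlet m (M m k) x := by
  induction s with
  | zero => simp [dirichlet, cyclicDirichlet]
  | succ s ih =>
    have h1 : dirichlet m ((s + 1) * M m k) x = dirichlet m (s * M m k) x +
        ∑ i ∈ Finset.range (M m k), psi m (s * M m k + i) x := by
      rw [dirichlet, Nat.succ_mul, Finset.sum_range_add]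
      rfl
    rw [h1, ih (Nat.le_of_succ_le hs), cyclicDirichlet, cyclicDirichlet, Finset.sum_range_succ,
      add_mul, dirichlet, Finset.mul_sum (Finset.range (M m k)) _ (ZMod.stdAddChar (x k) ^ s)]
    congr 1
    refine Finset.sum_congr rfl fun i hi => ?_
    rw [psi_mul_add m hm hs (Finset.mem_range.1 hi), rademacher_eq]

/-- The recursion behind all kernel estimates: the last, incomplete block of frequencies is a
modulated copy of `D_i`. -/
theorem dirichlet_mul_M_add (hm : ∀ j, 2 ≤ m j) {s k i : ℕ} (hi : i < M m k)
    (h : s * M m k + i ≤ M m (k + 1)) (x : Group m) :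
    dirichlet m (s * M m k + i) x =
      cyclicDirichlet (m k) s (x k) * dirichlet m (M m k) x +
        rademacher m k x ^ s * dirichlet m i x := by
  have hs : s ≤ m k :=
    Nat.le_of_mul_le_mul_right ((Nat.le_add_right _ i).trans h) (M_pos m k)
  rw [← dirichlet_mul_M m hm hs, dirichlet, Finset.sum_range_add]
  simp only [dirichlet, Finset.mul_sum]
  congr 1
  refine Finset.sum_congr rfl fun l hl => ?_
  have hl' := Finset.mem_range.1 hl
  -- The value `s = m k` is allowed, but only with `i = 0`; the existence of `l < i` forces `s < m
  -- k`.
  refine psi_mul_add m hm ?_ (hl'.trans hi) x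
  refine lt_of_mul_lt_mul_right (a := M m k) ?_ (Nat.zero_le _)
  rw [M] at h
  omega

theorem cyclicDirichlet_self (N : ℕ) [NeZero N] (t : ZMod N) :
    cyclicDirichlet N N t = if t = 0 then (N : ℂ) else 0 := by
  split_ifs with h
  · simp [cyclicDirichlet, h]
  · have h1 : (ZMod.stdAddChar t : ℂ) ≠ 1 := fun h1 => h
      (ZMod.injective_stdAddChar (h1.trans (AddChar.map_zero_eq_one _).symm))
    rw [cyclicDirichlet, geom_sum_eq h1, ← AddChar.map_nsmul_eq_pow]
    simp

theorem dirichlet_M (hm : ∀ j, 2 ≤ m j) (k : ℕ) (x : Group m) :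
    dirichlet m (M m k) x = (interval m k 0).indicator (fun _ => (M m k : ℂ)) x := by
  classical
  induction k with
  | zero => simp [dirichlet, M, interval, psi]
  | succ k ih =>
    rw [M, dirichlet_mul_M m hm le_rfl, ih, cyclicDirichlet_self]
    simp only [Set.indicator_apply, interval, Set.mem_ofPred_eq, Nat.forall_lt_succ_right,
      Pi.zero_apply]
    split_ifs <;> simp_all

theorem norm_rademacher (k : ℕ) (x : Group m) : ‖rademacher m k x‖ = 1 := by
  rw [rademacher_eq, AddChar.norm_apply]

end Characters

/-! ### Reduction to the finite groups of the first coordinates -/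

section Cells

variable (m : ℕ → ℕ)

/-- The finite group of the first `K` coordinates. -/
abbrev Cell (K : ℕ) : Type := (j : Finset.range K) → ZMod (m j)

/-- The point with the given first `K` coordinates, all others being zero. -/
def Cell.point {m : ℕ → ℕ} {K : ℕ} (z : Cell m K) : Group m :=
  fun j => if h : j ∈ Finset.range K then z ⟨j, h⟩ else 0

theorem Cell.point_apply {m : ℕ → ℕ} {K j : ℕ} (z : Cell m K) (h : j < K) :
    z.point j = z ⟨j, Finset.mem_range.2 h⟩ := by
  simp [Cell.point, h]

theorem Cell.point_sub {m : ℕ → ℕ} {K : ℕ} (z w : Cell m K) :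
    (z - w).point = z.point - w.point := by
  funext j
  by_cases h : j < K <;> simp [Cell.point, h]

theorem restrict_eq_iff {K : ℕ} (x : Group m) (z : Cell m K) :
    (Finset.range K).restrict x = z ↔ x ∈ interval m K z.point := by
  constructor
  · rintro rfl j hj
    rw [Cell.point_apply _ hj]
    rfl
  · intro h
    funext ⟨j, hj⟩
    have hj' := Finset.mem_range.1 hj
    rw [Finset.restrict, h j hj', Cell.point_apply _ hj']

theorem dependsOn_iff_point {β : Type*} {K : ℕ} {h : Group m → β}
    (hh : DependsOn h (Set.Iio K)) (x : Group m) :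
    h (Cell.point (m := m) ((Finset.range K).restrict x)) = h x := by
  refine hh fun j hj => ?_
  rw [Cell.point_apply _ hj]
  rfl

variable [∀ j, NeZero (m j)]

theorem card_cell (K : ℕ) : Fintype.card (Cell m K) = M m K := by
  have h : Fintype.card (Cell m K) = ∏ j : Finset.range K, Fintype.card (ZMod (m j)) :=
    Fintype.card_pi
  rw [h, M_eq_prod]
  simp only [ZMod.card]
  exact Finset.prod_coe_sort (Finset.range K) m

instance : IsProbabilityMeasure (haar m) := by
  unfold haar
  infer_instance

theorem haar_interval (K : ℕ) (x : Group m) : haar m (interval m K x) = (M m K : ℝ≥0∞)⁻¹ := by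
  have h : interval m K x = (Finset.range K : Set ℕ).pi fun j => {x j} := by
    ext y
    simp [interval]
  rw [h, haar, Measure.infinitePi_pi _ fun j _ => measurableSet_singleton _, M_eq_prod]
  push_cast
  rw [ENNReal.prod_inv_distrib]
  · refine Finset.prod_congr rfl fun j _ => ?_
    rw [uniformOn_univ, Measure.count_singleton, ZMod.card, one_div]
  · exact fun i _ j _ _ => Or.inr (ENNReal.natCast_ne_top _)

theorem map_restrict_singleton {K : ℕ} (z : Cell m K) :
    (haar m).map (Finset.range K).restrict {z} = (M m K : ℝ≥0∞)⁻¹ := by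
  rw [Measure.map_apply (Finset.measurable_restrict _) (measurableSet_singleton _),
    ← haar_interval m K z.point]
  congr 1
  ext x
  exact restrict_eq_iff m x z

theorem lintegral_dependsOn {K : ℕ} {h : Group m → ℝ≥0∞} (hh : DependsOn h (Set.Iio K)) :
    ∫⁻ x, h x ∂(haar m) = (M m K : ℝ≥0∞)⁻¹ * ∑ z : Cell m K, h z.point := by
  calc ∫⁻ x, h x ∂(haar m)
      = ∫⁻ x, h (Cell.point (m := m) ((Finset.range K).restrict x)) ∂(haar m) := by
        simp only [dependsOn_iff_point m hh]
    _ = ∫⁻ z, h (Cell.point (m := m) z) ∂((haar m).map (Finset.range K).restrict) :=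
        (lintegral_map (f := fun z : Cell m K => h z.point) (measurable_of_finite _)
          (Finset.measurable_restrict _)).symm
    _ = _ := by
        rw [lintegral_fintype, Finset.mul_sum]
        exact Finset.sum_congr rfl fun z _ => by rw [map_restrict_singleton, mul_comm]

theorem integral_dependsOn {K : ℕ} {h : Group m → ℂ} (hh : DependsOn h (Set.Iio K)) :
    ∫ x, h x ∂(haar m) = (M m K : ℂ)⁻¹ * ∑ z : Cell m K, h z.point := by
  have hr : Measurable ((Finset.range K).restrict : Group m → Cell m K) :=
    Finset.measurable_restrict _
  have hf : Measurable fun z : Cell m K => h z.point := measurable_of_finite _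
  calc ∫ x, h x ∂(haar m)
      = ∫ x, h (Cell.point (m := m) ((Finset.range K).restrict x)) ∂(haar m) := by
        simp only [dependsOn_iff_point m hh]
    _ = ∫ z, h (Cell.point (m := m) z) ∂((haar m).map (Finset.range K).restrict) :=
        (integral_map hr.aemeasurable hf.aestronglyMeasurable).symm
    _ = _ := by
        have : IsFiniteMeasure ((haar m).map (Finset.range K).restrict) := inferInstance
        rw [integral_fintype Integrable.of_finite, Finset.mul_sum]
        refine Finset.sum_congr rfl fun z _ => ?_
        rw [measureReal_def, map_restrict_singleton]
        simp

theorem dirichlet_point_sub (hm : ∀ j, 2 ≤ m j) {K : ℕ} (x : Group m) (z : Cell m K) :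
    dirichlet m (M m K) (x - z.point) =
      if (Finset.range K).restrict x = z then (M m K : ℂ) else 0 := by
  classical
  rw [dirichlet_M m hm, Set.indicator_apply]
  refine if_congr ?_ rfl rfl
  rw [restrict_eq_iff]
  simp [interval, sub_eq_zero]

/-- Convolution with `D_n`, as a finite sum, because `ψ_i` is a character. -/
theorem partialSum_dependsOn (hm : ∀ j, 2 ≤ m j) {K n : ℕ} (hn : n ≤ M m K) {h : Group m → ℂ}
    (hh : DependsOn h (Set.Iio K)) (x : Group m) :
    partialSum m n h x =
      (M m K : ℂ)⁻¹ * ∑ z : Cell m K, h z.point * dirichlet m n (x - z.point) := by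
  have h1 : ∀ i ∈ Finset.range n, coeff m h i * psi m i x =
      (M m K : ℂ)⁻¹ * ∑ z : Cell m K, h z.point * psi m i (x - z.point) := by
    intro i hi
    have hd : DependsOn (fun x => h x * conj (psi m i x)) (Set.Iio K) := by
      intro a b hab
      have h2 := dependsOn_psi m hm ((Finset.mem_range.1 hi).trans_le hn) hab
      simp only [hh hab, h2]
    rw [coeff, integral_dependsOn m hd, mul_assoc, Finset.sum_mul]
    congr 1
    refine Finset.sum_congr rfl fun z _ => ?_
    rw [psi_sub]
    ring
  rw [partialSum, Finset.sum_congr rfl h1, ← Finset.mul_sum, Finset.sum_comm]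
  simp only [dirichlet, Finset.mul_sum]

theorem partialSum_M_eq_self (hm : ∀ j, 2 ≤ m j) {K : ℕ} {h : Group m → ℂ}
    (hh : DependsOn h (Set.Iio K)) (x : Group m) : partialSum m (M m K) h x = h x := by
  have hM : (M m K : ℂ) ≠ 0 := Nat.cast_ne_zero.2 (M_pos m K).ne'
  rw [partialSum_dependsOn m hm le_rfl hh]
  simp only [dirichlet_point_sub m hm, mul_ite, mul_zero, Finset.sum_ite_eq, Finset.mem_univ,
    if_true]
  rw [dependsOn_iff_point m hh]
  field_simp

/-- Since `D_{M_K}` is `M_K` times a delta on cells, the character table `U` and its normalized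
adjoint `V` satisfy `U * V = 1`. There are as many cells as characters, so `V * U = 1` as well, and
this is orthonormality. -/
theorem coeff_psi (hm : ∀ j, 2 ≤ m j) (i l : ℕ) :
    coeff m (psi m l) i = if i = l then 1 else 0 := by
  classical
  let K := max i l
  have hi : i < M m K := (le_max_left i l).trans_lt (lt_M m hm K)
  have hl : l < M m K := (le_max_right i l).trans_lt (lt_M m hm K)
  have hM : (M m K : ℂ) ≠ 0 := Nat.cast_ne_zero.2 (M_pos m K).ne'
  let U : Matrix (Cell m K) (Fin (M m K)) ℂ := fun z a => psi m a z.point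
  let V : Matrix (Fin (M m K)) (Cell m K) ℂ := fun a z => (M m K : ℂ)⁻¹ * conj (psi m a z.point)
  have hUV : U * V = 1 := by
    ext z w
    have h1 : (U * V) z w = (M m K : ℂ)⁻¹ * dirichlet m (M m K) (z.point - w.point) := by
      rw [Matrix.mul_apply, dirichlet, Finset.mul_sum, ← Fin.sum_univ_eq_sum_range
        (fun a => (M m K : ℂ)⁻¹ * psi m a (z.point - w.point))]
      refine Finset.sum_congr rfl fun a _ => ?_
      simp only [U, V]
      rw [psi_sub]
      ring
    have h2 : (Finset.range K).restrict z.point = z :=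
      (restrict_eq_iff m _ z).2 fun _ _ => rfl
    rw [h1, dirichlet_point_sub m hm, h2, Matrix.one_apply]
    split_ifs
    · exact inv_mul_cancel₀ hM
    · exact mul_zero _
  have hVU : V * U = 1 :=
    (Matrix.mul_eq_one_comm_of_card_eq _ _ _ (by rw [card_cell, Fintype.card_fin])).1 hUV
  have h3 := congrFun (congrFun hVU ⟨i, hi⟩) ⟨l, hl⟩
  rw [Matrix.mul_apply, Matrix.one_apply] at h3
  simp only [Fin.mk.injEq] at h3
  have hd : DependsOn (fun x => psi m l x * conj (psi m i x)) (Set.Iio K) := by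
    intro a b hab
    simp only [dependsOn_psi m hm hi hab, dependsOn_psi m hm hl hab]
  rw [coeff, integral_dependsOn m hd, ← h3, Finset.mul_sum]
  refine Finset.sum_congr rfl fun z _ => ?_
  simp only [U, V]
  ring

theorem integrable_dependsOn {K : ℕ} {h : Group m → ℂ} (hh : DependsOn h (Set.Iio K)) :
    Integrable h (haar m) := by
  have h1 : Integrable (fun z : Cell m K => h z.point)
      ((haar m).map (Finset.range K).restrict) := Integrable.of_finite
  refine (h1.comp_measurable (Finset.measurable_restrict _)).congr (ae_of_all _ fun x => ?_)
  exact dependsOn_iff_point m hh x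

theorem coeff_sum_psi (hm : ∀ j, 2 ≤ m j) (c : ℕ → ℂ) (n i : ℕ) :
    coeff m (fun x => ∑ l ∈ Finset.range n, c l * psi m l x) i = if i < n then c i else 0 := by
  have hint : ∀ l ∈ Finset.range n,
      Integrable (fun x => c l * (psi m l x * conj (psi m i x))) (haar m) := by
    intro l _
    refine (integrable_dependsOn m (K := max i l) fun a b hab => ?_).const_mul _
    simp only [dependsOn_psi m hm ((le_max_left i l).trans_lt (lt_M m hm _)) hab,
      dependsOn_psi m hm ((le_max_right i l).trans_lt (lt_M m hm _)) hab]
  have h1 : ∀ l, ∫ x, psi m l x * conj (psi m i x) ∂(haar m) = if i = l then 1 else 0 :=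
    coeff_psi m hm i
  simp only [coeff, Finset.sum_mul, mul_assoc]
  rw [integral_finsetSum _ hint]
  simp only [integral_const_mul, h1, mul_ite, mul_one, mul_zero, Finset.sum_ite_eq,
    Finset.mem_range]

theorem partialSum_sum_psi (hm : ∀ j, 2 ≤ m j) (c : ℕ → ℂ) (N n : ℕ) (x : Group m) :
    partialSum m N (fun x => ∑ l ∈ Finset.range n, c l * psi m l x) x =
      ∑ l ∈ Finset.range (min N n), c l * psi m l x := by
  simp only [partialSum, coeff_sum_psi m hm, ite_mul, zero_mul]
  rw [← Finset.sum_filter]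
  refine Finset.sum_congr ?_ fun _ _ => rfl
  ext i
  simp

end Cells

/-! ### Martingales as formal Vilenkin series -/

section Martingales

variable (m : ℕ → ℕ) [∀ j, NeZero (m j)]

theorem filtration_le_comap (K : ℕ) :
    filtration m K ≤ MeasurableSpace.comap ((Finset.range K).restrict : Group m → Cell m K) ⊤ := by
  refine MeasurableSpace.generateFrom_le ?_
  rintro _ ⟨x, rfl⟩
  refine ⟨{(Finset.range K).restrict x}, trivial, ?_⟩
  ext y
  simp only [Set.mem_preimage, Set.mem_singleton_iff, restrict_eq_iff]
  refine forall₂_congr fun j hj => ?_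
  rw [Cell.point_apply _ hj]
  rfl

/-- Sets of `filtration m K` are unions of cells, so the dependence holds at every point and later
identities for `f j` need no null sets. -/
theorem dependsOn_of_stronglyMeasurable {K : ℕ} {h : Group m → ℂ}
    (hh : StronglyMeasurable[filtration m K] h) : DependsOn h (Set.Iio K) := by
  intro x y hxy
  have h1 : MeasurableSet[filtration m K] (h ⁻¹' {h x}) :=
    hh.measurable (measurableSet_singleton (h x))
  obtain ⟨S, -, hS⟩ := filtration_le_comap m K _ h1
  have hr : (Finset.range K).restrict x = (Finset.range K).restrict y :=
    funext fun j => hxy j (Finset.mem_range.1 j.2)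
  have hx : x ∈ (Finset.range K).restrict ⁻¹' S := hS ▸ rfl
  have hy : y ∈ (Finset.range K).restrict ⁻¹' S := by
    rw [Set.mem_preimage] at hx ⊢
    rwa [← hr]
  rw [hS] at hy
  exact hy.symm

/-- Reduces a pairing to integrals over atoms of the filtration, on which the martingale property
acts directly. -/
theorem integral_mul_dependsOn {K : ℕ} {F φ : Group m → ℂ} (hF : Integrable F (haar m))
    (hφ : DependsOn φ (Set.Iio K)) :
    ∫ x, F x * φ x ∂(haar m) =
      ∑ z : Cell m K, φ z.point * ∫ x in interval m K z.point, F x ∂(haar m) := by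
  classical
  have h1 : ∀ x, F x * φ x =
      ∑ z : Cell m K, (interval m K z.point).indicator (fun x => φ z.point * F x) x := by
    intro x
    simp only [Set.indicator_apply, ← restrict_eq_iff, Finset.sum_ite_eq, Finset.mem_univ, if_true]
    rw [dependsOn_iff_point m hφ, mul_comm]
  simp only [h1]
  rw [integral_finsetSum _ fun z _ =>
    (hF.const_mul _).indicator (measurableSet_interval m K z.point)]
  refine Finset.sum_congr rfl fun z _ => ?_
  rw [integral_indicator (measurableSet_interval m K z.point), integral_const_mul]

theorem martingaleCoeff_eq (hm : ∀ j, 2 ≤ m j) {f : ℕ → Group m → ℂ}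
    (hf : Martingale f (filtration m) (haar m)) {i j : ℕ} (hi : i < M m j) :
    martingaleCoeff m f i = coeff m (f j) i := by
  have hd : DependsOn (fun x => conj (psi m i x)) (Set.Iio j) := fun a b hab => by
    simp only [dependsOn_psi m hm hi hab]
  refine Tendsto.limUnder_eq (tendsto_const_nhds.congr' ?_)
  -- The sequence defining the coefficient is constant from level `j` on.
  filter_upwards [eventually_ge_atTop j] with k hk
  rw [coeff, integral_mul_dependsOn m (hf.integrable j) hd,
    integral_mul_dependsOn m (hf.integrable k) hd]
  refine Finset.sum_congr rfl fun z _ => ?_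
  rw [hf.setIntegral_eq hk (MeasurableSpace.measurableSet_generateFrom ⟨_, rfl⟩)]

theorem martingale_eq_martingalePartialSum (hm : ∀ j, 2 ≤ m j) {f : ℕ → Group m → ℂ}
    (hf : Martingale f (filtration m) (haar m)) (j : ℕ) :
    f j = martingalePartialSum m (M m j) f := by
  funext x
  rw [← partialSum_M_eq_self m hm
    (dependsOn_of_stronglyMeasurable m (hf.stronglyMeasurable j)) x]
  exact Finset.sum_congr rfl fun i hi => by
    rw [martingaleCoeff_eq m hm hf (Finset.mem_range.1 hi)]

theorem partialSum_martingalePartialSum (hm : ∀ j, 2 ≤ m j) (f : ℕ → Group m → ℂ) (N n : ℕ) :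
    partialSum m N (martingalePartialSum m n f) = martingalePartialSum m (min N n) f :=
  funext fun x => partialSum_sum_psi m hm (martingaleCoeff m f) N n x

theorem dependsOn_martingalePartialSum (hm : ∀ j, 2 ≤ m j) (f : ℕ → Group m → ℂ) {n K : ℕ}
    (hn : n ≤ M m K) : DependsOn (martingalePartialSum m n f) (Set.Iio K) := fun a b hab =>
  Finset.sum_congr rfl fun i hi => by
    rw [dependsOn_psi m hm ((Finset.mem_range.1 hi).trans_le hn) hab]

theorem partialSum_sub {K n : ℕ} (hm : ∀ j, 2 ≤ m j) (hn : n ≤ M m K) {g h : Group m → ℂ}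
    (hg : DependsOn g (Set.Iio K)) (hh : DependsOn h (Set.Iio K)) :
    partialSum m n (g - h) = partialSum m n g - partialSum m n h := by
  have hgh : DependsOn (g - h) (Set.Iio K) := fun a b hab => by
    simp only [Pi.sub_apply, hg hab, hh hab]
  funext x
  simp only [Pi.sub_apply, partialSum_dependsOn m hm hn hg, partialSum_dependsOn m hm hn hh,
    partialSum_dependsOn m hm hn hgh, sub_mul, Finset.sum_sub_distrib, mul_sub]

/-! ### The convolution estimate for `p ≤ 1` -/

theorem rpow_sum_le_sum_rpow {ι : Type*} (s : Finset ι) (a : ι → ℝ≥0∞) {p : ℝ} (hp0 : 0 < p)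
    (hp1 : p ≤ 1) : (∑ i ∈ s, a i) ^ p ≤ ∑ i ∈ s, a i ^ p := by
  classical
  induction s using Finset.induction_on with
  | empty => simp [hp0]
  | insert i s hi ih =>
    rw [Finset.sum_insert hi, Finset.sum_insert hi]
    exact (ENNReal.rpow_add_le_add_rpow _ _ hp0.le hp1).trans (by gcongr)

/-- Taking the `p`-th power inside the convolution sum and summing over translates leaves `M_K ^
(-p)` from its normalization, while the two sums over cells are `M_K` times integrals and the outer
average gives `M_K⁻¹`. The balance is `M_K ^ (1 - p)`. -/
theorem lintegral_partialSum_rpow_le (hm : ∀ j, 2 ≤ m j) {p : ℝ} (hp0 : 0 < p) (hp1 : p ≤ 1)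
    {K n : ℕ} (hn : n ≤ M m K) {h : Group m → ℂ} (hh : DependsOn h (Set.Iio K)) :
    ∫⁻ x, ‖partialSum m n h x‖ₑ ^ p ∂(haar m) ≤
      (M m K : ℝ≥0∞) ^ (1 - p) * (∫⁻ x, ‖dirichlet m n x‖ₑ ^ p ∂(haar m)) *
        ∫⁻ x, ‖h x‖ₑ ^ p ∂(haar m) := by
  set N : ℝ≥0∞ := (M m K : ℝ≥0∞) with hN
  have hN0 : N ≠ 0 := Nat.cast_ne_zero.2 (M_pos m K).ne'
  have hNt : N ≠ ∞ := ENNReal.natCast_ne_top _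
  have hps : DependsOn (fun x => ‖partialSum m n h x‖ₑ ^ p) (Set.Iio K) := fun a b hab => by
    have : partialSum m n h a = partialSum m n h b :=
      Finset.sum_congr rfl fun i hi => by
        rw [dependsOn_psi m hm ((Finset.mem_range.1 hi).trans_le hn) hab]
    simp only [this]
  have hdp : DependsOn (fun x => ‖dirichlet m n x‖ₑ ^ p) (Set.Iio K) := fun a b hab => by
    simp only [dependsOn_dirichlet m hm hn hab]
  have hhp : DependsOn (fun x => ‖h x‖ₑ ^ p) (Set.Iio K) := fun a b hab => by simp only [hh hab]
  rw [lintegral_dependsOn m hps, lintegral_dependsOn m hdp, lintegral_dependsOn m hhp, ← hN]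
  have hpt : ∀ w : Cell m K, ‖partialSum m n h w.point‖ₑ ^ p ≤
      N⁻¹ ^ p * ∑ z : Cell m K, ‖h z.point‖ₑ ^ p * ‖dirichlet m n (w - z).point‖ₑ ^ p := by
    intro w
    have hNe : ‖(M m K : ℂ)⁻¹‖ₑ = N⁻¹ := by
      rw [enorm_inv (Nat.cast_ne_zero.2 (M_pos m K).ne'), hN]
      simp [enorm]
    rw [partialSum_dependsOn m hm hn hh, enorm_mul, ENNReal.mul_rpow_of_nonneg _ _ hp0.le, hNe]
    gcongr
    refine (ENNReal.rpow_le_rpow (enorm_sum_le _ _) hp0.le).trans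
      ((rpow_sum_le_sum_rpow _ _ hp0 hp1).trans_eq ?_)
    refine Finset.sum_congr rfl fun z _ => ?_
    rw [enorm_mul, ENNReal.mul_rpow_of_nonneg _ _ hp0.le, Cell.point_sub]
  have hshift : ∀ z : Cell m K, ∑ w : Cell m K, ‖dirichlet m n (w - z).point‖ₑ ^ p =
      ∑ w : Cell m K, ‖dirichlet m n w.point‖ₑ ^ p := fun z =>
    (Equiv.subRight z).sum_comp fun w : Cell m K => ‖dirichlet m n w.point‖ₑ ^ p
  calc N⁻¹ * ∑ w : Cell m K, ‖partialSum m n h w.point‖ₑ ^ p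
      ≤ N⁻¹ * ∑ w : Cell m K, N⁻¹ ^ p *
          ∑ z : Cell m K, ‖h z.point‖ₑ ^ p * ‖dirichlet m n (w - z).point‖ₑ ^ p := by
        gcongr with w
        exact hpt w
    _ = N⁻¹ ^ p * N⁻¹ * ((∑ w : Cell m K, ‖dirichlet m n w.point‖ₑ ^ p) *
          ∑ z : Cell m K, ‖h z.point‖ₑ ^ p) := by
        rw [← Finset.mul_sum, Finset.sum_comm]
        simp only [← Finset.mul_sum, hshift]
        rw [← Finset.sum_mul]
        ring
    _ = _ := by
        have : N⁻¹ ^ p = N ^ (1 - p) * N⁻¹ := by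
          rw [ENNReal.rpow_sub _ _ hN0 hNt, ENNReal.rpow_one, ENNReal.inv_rpow, div_eq_mul_inv,
            mul_right_comm, ENNReal.mul_inv_cancel hN0 hNt, one_mul]
        rw [this]
        ring

end Martingales

/-! ### Counting bound for truncated reciprocals -/

section Cutoff

variable (N : ℕ)

/-- The number of `u ∈ [1, s]` with `2 u v ≤ N`, which is essentially `min s (N / (2 v))`. -/
noncomputable def cutoffCount (s v : ℕ) : ℝ :=
  ∑ u ∈ Finset.Icc 1 s, if 2 * u * v ≤ N then 1 else 0

theorem cutoffCount_nonneg (s v : ℕ) : 0 ≤ cutoffCount N s v :=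
  Finset.sum_nonneg fun u _ => by split_ifs <;> norm_num

theorem le_one_add_cutoffCount {X : ℝ} {s v : ℕ} (hv : 0 < v) (hs : X ≤ s)
    (hX : X ≤ N / (2 * v)) : X ≤ 1 + cutoffCount N s v := by
  set q := min s (N / (2 * v)) with hq
  have h1 : (q : ℝ) ≤ cutoffCount N s v := by
    have : (q : ℝ) = ∑ u ∈ Finset.Icc 1 q, if 2 * u * v ≤ N then (1 : ℝ) else 0 := by
      rw [Finset.sum_congr rfl fun u hu => if_pos ?_]
      · simp
      · have h2 : u ≤ N / (2 * v) := (Finset.mem_Icc.1 hu).2.trans (min_le_right _ _)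
        have h3 := (Nat.le_div_iff_mul_le (by omega)).1 h2
        calc 2 * u * v = u * (2 * v) := by ring
          _ ≤ N := h3
    rw [this]
    refine Finset.sum_le_sum_of_subset_of_nonneg
      (Finset.Icc_subset_Icc_right (min_le_left _ _)) fun u _ _ => ?_
    split_ifs <;> norm_num
  -- Rounding `N / (2 v)` down loses less than `1`.
  have h2 : X ≤ 1 + q := by
    rcases le_total s (N / (2 * v)) with h | h
    · rw [hq, min_eq_left h]
      linarith
    · rw [hq, min_eq_right h]
      have h3 : N < 2 * v * (N / (2 * v) + 1) := Nat.lt_mul_div_succ N (by omega)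
      have h4 : (N : ℝ) < 2 * v * ((N / (2 * v) : ℕ) + 1) := by exact_mod_cast h3
      have hv' : (0 : ℝ) < 2 * v := by positivity
      refine hX.trans ?_
      rw [div_le_iff₀ hv']
      nlinarith
  linarith

/-- Exchanging the sums leaves at most `N / (2 u)` values of `v` for each `u ≤ s`: a harmonic sum up
to `s`, so the logarithm is of `s` and not of `N`. -/
theorem sum_cutoffCount_le (s : ℕ) :
    ∑ v ∈ Finset.Ico 1 N, cutoffCount N s v ≤ N / 2 * (1 + Real.log s) := by
  have h1 : ∀ u ∈ Finset.Icc 1 s,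
      (∑ v ∈ Finset.Ico 1 N, if 2 * u * v ≤ N then (1 : ℝ) else 0) ≤ N / 2 * (u : ℝ)⁻¹ := by
    intro u hu
    have hu0 : 0 < u := (Finset.mem_Icc.1 hu).1
    rw [Finset.sum_boole]
    have h2 : (Finset.Ico 1 N).filter (fun v => 2 * u * v ≤ N) ⊆
        Finset.Icc 1 (N / (2 * u)) := by
      intro v hv
      rw [Finset.mem_filter, Finset.mem_Ico] at hv
      rw [Finset.mem_Icc, Nat.le_div_iff_mul_le (by omega), mul_comm]
      exact ⟨hv.1.1, hv.2⟩
    have h3 := Finset.card_le_card h2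
    rw [Nat.card_Icc, Nat.add_sub_cancel] at h3
    calc (((Finset.Ico 1 N).filter (fun v => 2 * u * v ≤ N)).card : ℝ)
        ≤ ((N / (2 * u) : ℕ) : ℝ) := by exact_mod_cast h3
      _ ≤ (N : ℝ) / ((2 * u : ℕ) : ℝ) := Nat.cast_div_le
      _ = N / 2 * (u : ℝ)⁻¹ := by
        push_cast
        field_simp
  have h4 := harmonic_le_one_add_log s
  rw [harmonic_eq_sum_Icc] at h4
  push_cast at h4
  calc ∑ v ∈ Finset.Ico 1 N, cutoffCount N s v
      = ∑ u ∈ Finset.Icc 1 s, ∑ v ∈ Finset.Ico 1 N, if 2 * u * v ≤ N then (1 : ℝ) else 0 :=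
        Finset.sum_comm
    _ ≤ ∑ u ∈ Finset.Icc 1 s, N / 2 * (u : ℝ)⁻¹ := Finset.sum_le_sum h1
    _ = N / 2 * ∑ u ∈ Finset.Icc 1 s, (u : ℝ)⁻¹ := by rw [Finset.mul_sum]
    _ ≤ N / 2 * (1 + Real.log s) := by gcongr

end Cutoff

/-! ### The `L¹` norm of the cyclic Dirichlet kernel -/

section Cyclic

variable (N : ℕ) [NeZero N]

theorem norm_cyclicDirichlet_le (s : ℕ) (t : ZMod N) : ‖cyclicDirichlet N s t‖ ≤ s := by
  refine (norm_sum_le _ _).trans ?_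
  simp [norm_pow, AddChar.norm_apply]

theorem norm_stdAddChar_sub_one (t : ZMod N) :
    ‖(ZMod.stdAddChar t : ℂ) - 1‖ = 2 * Real.sin (Real.pi * t.val / N) := by
  have hN : (0 : ℝ) < N := Nat.cast_pos.2 (NeZero.pos N)
  have ht : (t.val : ℝ) ≤ N := by exact_mod_cast (ZMod.val_lt t).le
  have h1 : (ZMod.stdAddChar t : ℂ) =
      Complex.exp (Complex.I * ((2 * Real.pi * t.val / N : ℝ) : ℂ)) := by
    rw [ZMod.stdAddChar_apply, ZMod.toCircle_apply]
    congr 1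
    push_cast
    ring
  have h2 : 2 * Real.pi * t.val / N / 2 = Real.pi * t.val / N := by ring
  rw [h1, Complex.norm_exp_I_mul_ofReal_sub_one, h2, Real.norm_eq_abs, abs_of_nonneg]
  refine mul_nonneg zero_le_two (Real.sin_nonneg_of_nonneg_of_le_pi (by positivity) ?_)
  rw [div_le_iff₀ hN]
  exact mul_le_mul_of_nonneg_left ht Real.pi_pos.le

theorem sin_pi_mul_div_ge {v : ℝ} (hv : 0 ≤ v) (h : 2 * v ≤ N) :
    2 * v / N ≤ Real.sin (Real.pi * v / N) := by
  have hN : (0 : ℝ) < N := Nat.cast_pos.2 (NeZero.pos N)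
  have h1 : Real.pi * v / N ≤ Real.pi / 2 := by
    rw [div_le_div_iff₀ hN two_pos]
    nlinarith [Real.pi_pos]
  refine le_of_eq_of_le ?_ (Real.mul_le_sin (by positivity) h1)
  field_simp

theorem norm_cyclicDirichlet_le_inv_sin (s : ℕ) {t : ZMod N} (ht : t ≠ 0) :
    ‖cyclicDirichlet N s t‖ ≤ (Real.sin (Real.pi * t.val / N))⁻¹ := by
  have h1 : (ZMod.stdAddChar t : ℂ) ≠ 1 := fun h1 => ht
    (ZMod.injective_stdAddChar (h1.trans (AddChar.map_zero_eq_one _).symm))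
  rw [cyclicDirichlet, geom_sum_eq h1, norm_div, norm_stdAddChar_sub_one]
  have h2 : 0 < 2 * Real.sin (Real.pi * t.val / N) := by
    rw [← norm_stdAddChar_sub_one]
    exact norm_pos_iff.2 (sub_ne_zero.2 h1)
  have h3 : ‖(ZMod.stdAddChar t : ℂ) ^ s - 1‖ ≤ 2 := by
    refine (norm_sub_le _ _).trans ?_
    rw [norm_pow, AddChar.norm_apply, one_pow, norm_one]
    norm_num
  rw [div_le_iff₀ h2]
  have h4 : Real.sin (Real.pi * t.val / N) ≠ 0 := by
    intro h
    rw [h, mul_zero] at h2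
    exact lt_irrefl _ h2
  rw [mul_left_comm, inv_mul_cancel₀ h4, mul_one]
  exact h3

/-- The sine is symmetric under `v ↦ N - v`, and Jordan's inequality applies to whichever of the two
is at most `N / 2`. Keeping both counts avoids splitting the later sum. -/
theorem norm_cyclicDirichlet_le_cutoffCount (s : ℕ) {t : ZMod N} (ht : t ≠ 0) :
    ‖cyclicDirichlet N s t‖ ≤ 1 + (cutoffCount N s t.val + cutoffCount N s (N - t.val)) := by
  have hN : (0 : ℝ) < N := Nat.cast_pos.2 (NeZero.pos N)
  have hlt := ZMod.val_lt t
  have hpos : 0 < t.val := Nat.pos_of_ne_zero fun h => ht ((ZMod.val_eq_zero t).1 h)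
  have h0 := cutoffCount_nonneg N s t.val
  have h0' := cutoffCount_nonneg N s (N - t.val)
  have hinv := norm_cyclicDirichlet_le_inv_sin N s ht
  have key : ∀ w : ℕ, 0 < w → 2 * w ≤ N →
      Real.sin (Real.pi * t.val / N) = Real.sin (Real.pi * w / N) →
      ‖cyclicDirichlet N s t‖ ≤ 1 + cutoffCount N s w := by
    intro w hw hwN hsin
    refine le_one_add_cutoffCount N hw (norm_cyclicDirichlet_le N s t) (hinv.trans ?_)
    have hw' : (0 : ℝ) < w := Nat.cast_pos.2 hw
    rw [hsin, ← inv_div (2 * (w : ℝ))]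
    exact inv_anti₀ (by positivity) (sin_pi_mul_div_ge N hw'.le (by exact_mod_cast hwN))
  rcases le_total (2 * t.val) N with h | h
  · have := key t.val hpos h rfl
    linarith
  · have := key (N - t.val) (by omega) (by omega) (by
      rw [Nat.cast_sub hlt.le, ← Real.sin_pi_sub]
      congr 1
      field_simp)
    linarith

theorem sum_zmod_val (F : ℕ → ℝ) : ∑ t : ZMod N, F t.val = ∑ v ∈ Finset.range N, F v :=
  Finset.sum_nbij' ZMod.val (fun v => (v : ZMod N))
    (fun t _ => Finset.mem_range.2 (ZMod.val_lt t)) (fun _ _ => Finset.mem_univ _)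
    (fun t _ => ZMod.natCast_rightInverse t)
    (fun v hv => ZMod.val_cast_of_lt (Finset.mem_range.1 hv)) fun _ _ => rfl

theorem sum_norm_cyclicDirichlet_le {s : ℕ} (hs : s ≤ N) :
    ∑ t : ZMod N, ‖cyclicDirichlet N s t‖ ≤ N * (6 * Real.log (s + 1)) := by
  rcases Nat.eq_zero_or_pos s with rfl | hs0
  · simp [cyclicDirichlet]
  have hN : 0 < N := NeZero.pos N
  have hs1 : (1 : ℝ) ≤ s := by exact_mod_cast hs0
  let F : ℕ → ℝ := fun v =>
    if v = 0 then s else 1 + (cutoffCount N s v + cutoffCount N s (N - v))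
  have h1 : ∀ t : ZMod N, ‖cyclicDirichlet N s t‖ ≤ F t.val := by
    intro t
    by_cases ht : t = 0
    · simpa [F, ht] using norm_cyclicDirichlet_le N s t
    · simpa [F, ZMod.val_eq_zero, ht] using norm_cyclicDirichlet_le_cutoffCount N s ht
  have h2 : ∑ v ∈ Finset.Ico 1 N, cutoffCount N s (N - v) =
      ∑ v ∈ Finset.Ico 1 N, cutoffCount N s v :=
    Finset.sum_nbij' (fun v => N - v) (fun v => N - v)
      (fun v hv => by simp only [Finset.mem_Ico] at hv ⊢; omega)
      (fun v hv => by simp only [Finset.mem_Ico] at hv ⊢; omega)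
      (fun v hv => by simp only [Finset.mem_Ico] at hv; omega)
      (fun v hv => by simp only [Finset.mem_Ico] at hv; omega) fun _ _ => rfl
  have h3 : ∑ v ∈ Finset.Ico 1 N, F v =
      (N - 1) + 2 * ∑ v ∈ Finset.Ico 1 N, cutoffCount N s v := by
    rw [Finset.sum_congr rfl fun _ hv => if_neg (Nat.one_le_iff_ne_zero.1 (Finset.mem_Ico.1 hv).1),
      Finset.sum_add_distrib, Finset.sum_add_distrib, h2]
    simp [Nat.cast_sub hN]
    ring
  have h4 := sum_cutoffCount_le N s
  have h5 : Real.log 2 ≤ Real.log (s + 1) := Real.log_le_log two_pos (by linarith)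
  have h6 : Real.log s ≤ Real.log (s + 1) := Real.log_le_log (by linarith) (by linarith)
  have h7 := Real.log_two_gt_d9
  have hsN : (s : ℝ) ≤ N := by exact_mod_cast hs
  calc ∑ t : ZMod N, ‖cyclicDirichlet N s t‖
      ≤ ∑ t : ZMod N, F t.val := Finset.sum_le_sum fun t _ => h1 t
    _ = F 0 + ∑ v ∈ Finset.Ico 1 N, F v := by
        rw [sum_zmod_val, Finset.range_eq_Ico, Finset.sum_eq_sum_Ico_succ_bot hN]
    -- The point `t = 0` contributes `s ≤ N`, the constants `1` contribute `N - 1`, and the two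
    -- counts contribute `N (1 + log s)`.
    _ ≤ N * (3 + Real.log s) := by
        rw [h3]
        simp only [F, if_true]
        nlinarith
    -- Here `3 ≤ 5 log 2 ≤ 5 log (s + 1)`.
    _ ≤ N * (6 * Real.log (s + 1)) := by
        gcongr
        nlinarith

end Cyclic

/-! ### Integrals of powers of the Dirichlet kernels -/

section Kernel

variable (m : ℕ → ℕ) [∀ j, NeZero (m j)]

/-- The kernel `D_{M_k}` lives on `I_k(0)`, which the coordinate `x_k` splits into `m k` intervals
of equal measure `1 / M_{k+1}`. -/
theorem lintegral_cyclicDirichlet_mul_dirichlet (hm : ∀ j, 2 ≤ m j) {p : ℝ} (hp0 : 0 < p)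
    (k s : ℕ) :
    ∫⁻ x, ‖cyclicDirichlet (m k) s (x k) * dirichlet m (M m k) x‖ₑ ^ p ∂(haar m) =
      (M m k : ℝ≥0∞) ^ (p - 1) *
        ((m k : ℝ≥0∞)⁻¹ * ∑ t : ZMod (m k), ‖cyclicDirichlet (m k) s t‖ₑ ^ p) := by
  classical
  have hM0 : (M m k : ℝ≥0∞) ≠ 0 := Nat.cast_ne_zero.2 (M_pos m k).ne'
  have hMt : (M m k : ℝ≥0∞) ≠ ∞ := ENNReal.natCast_ne_top _
  have hmem : ∀ (x : Group m) (t : ZMod (m k)),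
      x ∈ interval m (k + 1) (Function.update 0 k t) ↔ x ∈ interval m k 0 ∧ x k = t := by
    intro x t
    simp only [interval, Set.mem_ofPred_eq, Nat.forall_lt_succ_right, Function.update_self]
    refine and_congr_left fun _ => forall₂_congr fun j hj => ?_
    rw [Function.update_of_ne hj.ne]
  have hpt : ∀ x : Group m, ‖cyclicDirichlet (m k) s (x k) * dirichlet m (M m k) x‖ₑ ^ p =
      ∑ t : ZMod (m k), (interval m (k + 1) (Function.update 0 k t)).indicator
        (fun _ => ‖cyclicDirichlet (m k) s t‖ₑ ^ p * (M m k : ℝ≥0∞) ^ p) x := by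
    intro x
    simp only [Set.indicator_apply, hmem, dirichlet_M m hm]
    by_cases hx : x ∈ interval m k 0
    · simp [hx, ENNReal.mul_rpow_of_nonneg _ _ hp0.le, enorm]
    · simp [hx, hp0]
  simp only [hpt]
  rw [lintegral_finsetSum _ fun t _ =>
    measurable_const.indicator (measurableSet_interval m _ _)]
  simp only [lintegral_indicator_const (measurableSet_interval m _ _), haar_interval]
  rw [← Finset.sum_mul, ← Finset.sum_mul, ENNReal.rpow_sub _ _ hM0 hMt, ENNReal.rpow_one,
    div_eq_mul_inv, M, Nat.cast_mul, ENNReal.mul_inv (Or.inr hMt) (Or.inr hM0)]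
  ring

theorem lintegral_dirichlet_mul_M_add_le (hm : ∀ j, 2 ≤ m j) {p : ℝ} (hp0 : 0 < p)
    (hp1 : p ≤ 1) {s k i : ℕ} (hi : i < M m k) (h : s * M m k + i ≤ M m (k + 1)) :
    ∫⁻ x, ‖dirichlet m (s * M m k + i) x‖ₑ ^ p ∂(haar m) ≤
      (M m k : ℝ≥0∞) ^ (p - 1) *
        ((m k : ℝ≥0∞)⁻¹ * ∑ t : ZMod (m k), ‖cyclicDirichlet (m k) s t‖ₑ ^ p) +
      ∫⁻ x, ‖dirichlet m i x‖ₑ ^ p ∂(haar m) := by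
  have hmeas : AEMeasurable (fun x => ‖dirichlet m i x‖ₑ ^ p) (haar m) :=
    (integrable_dependsOn m
      (dependsOn_dirichlet m hm hi.le)).aestronglyMeasurable.enorm.pow_const p
  rw [← lintegral_cyclicDirichlet_mul_dirichlet m hm hp0, ← lintegral_add_right' _ hmeas]
  refine lintegral_mono fun x => ?_
  rw [dirichlet_mul_M_add m hm hi h]
  refine (ENNReal.rpow_le_rpow (enorm_add_le _ _) hp0.le).trans
    ((ENNReal.rpow_add_le_add_rpow _ _ hp0.le hp1).trans_eq ?_)
  congr 2
  rw [enorm_mul, ← ofReal_norm (rademacher m k x ^ s), norm_pow, norm_rademacher]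
  simp

/-- Induction on the number of digits. The shape `log (n + 1)` with a fixed constant reproduces
itself, because the logarithms of `s + 1` and `i + 1` combine into one. -/
theorem lintegral_enorm_dirichlet_le (hm : ∀ j, 2 ≤ m j) (n : ℕ) :
    ∫⁻ x, ‖dirichlet m n x‖ₑ ∂(haar m) ≤ ENNReal.ofReal (6 * Real.log (n + 1)) := by
  suffices H : ∀ k n, n < M m k →
      ∫⁻ x, ‖dirichlet m n x‖ₑ ∂(haar m) ≤ ENNReal.ofReal (6 * Real.log (n + 1)) from
    H n n (lt_M m hm n)
  intro k
  induction k with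
  | zero =>
    intro n hn
    obtain rfl : n = 0 := by simpa [M] using hn
    simp [dirichlet]
  | succ k ih =>
    intro n hn
    obtain ⟨s, i, hi, rfl⟩ : ∃ s i, i < M m k ∧ n = s * M m k + i :=
      ⟨n / M m k, n % M m k, Nat.mod_lt _ (M_pos m k), (Nat.div_add_mod' n (M m k)).symm⟩
    have hs : s ≤ m k :=
      Nat.le_of_mul_le_mul_right ((Nat.le_add_right _ i).trans hn.le) (M_pos m k)
    have h1 := lintegral_dirichlet_mul_M_add_le m hm one_pos le_rfl hi hn.le
    simp only [ENNReal.rpow_one, sub_self, ENNReal.rpow_zero, one_mul] at h1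
    have h2 : (m k : ℝ≥0∞)⁻¹ * ∑ t : ZMod (m k), ‖cyclicDirichlet (m k) s t‖ₑ ≤
        ENNReal.ofReal (6 * Real.log (s + 1)) := by
      have h3 : ∑ t : ZMod (m k), ‖cyclicDirichlet (m k) s t‖ₑ =
          ENNReal.ofReal (∑ t : ZMod (m k), ‖cyclicDirichlet (m k) s t‖) := by
        rw [ENNReal.ofReal_sum_of_nonneg fun _ _ => norm_nonneg _]
        simp only [ofReal_norm]
      rw [h3, ENNReal.inv_mul_le_iff (Nat.cast_ne_zero.2 (NeZero.ne (m k)))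
        (ENNReal.natCast_ne_top _), ← ENNReal.ofReal_natCast,
        ← ENNReal.ofReal_mul (Nat.cast_nonneg _)]
      exact ENNReal.ofReal_le_ofReal (sum_norm_cyclicDirichlet_le (m k) hs)
    refine h1.trans ((add_le_add h2 (ih i hi)).trans ?_)
    have hs0 : 0 ≤ Real.log ((s : ℝ) + 1) := Real.log_nonneg (by simp)
    have hi0 : 0 ≤ Real.log ((i : ℝ) + 1) := Real.log_nonneg (by simp)
    rw [← ENNReal.ofReal_add (by positivity) (by positivity), ← mul_add,
      ← Real.log_mul (by positivity) (by positivity)]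
    refine ENNReal.ofReal_le_ofReal (mul_le_mul_of_nonneg_left
      (Real.log_le_log (by positivity) ?_) (by norm_num))
    -- This uses `i + 1 ≤ M_k`.
    have h4 : (s + 1) * (i + 1) ≤ s * M m k + i + 1 := by
      have := Nat.mul_le_mul_left s (Nat.succ_le_of_lt hi)
      simp only [Nat.succ_eq_add_one] at this
      nlinarith
    exact_mod_cast h4

/-- The digit at place `j` costs at most `B M_j ^ (p - 1) ≤ B (2 ^ (p - 1)) ^ j`, and the geometric
series bounds the total. At `p = 1` the right-hand side is `∞`. -/
theorem lintegral_enorm_dirichlet_rpow_le (hm : ∀ j, 2 ≤ m j) {p : ℝ} (hp0 : 0 < p)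
    (hp1 : p ≤ 1) {B : ℕ} (hB : ∀ j, m j ≤ B) (n : ℕ) :
    ∫⁻ x, ‖dirichlet m n x‖ₑ ^ p ∂(haar m) ≤ B * (1 - 2 ^ (p - 1))⁻¹ := by
  suffices H : ∀ k n, n < M m k →
      ∫⁻ x, ‖dirichlet m n x‖ₑ ^ p ∂(haar m) ≤
        B * ∑ j ∈ Finset.range k, ((2 : ℝ≥0∞) ^ (p - 1)) ^ j by
    refine (H n n (lt_M m hm n)).trans ?_
    rw [← ENNReal.tsum_geometric]
    gcongr
    exact ENNReal.sum_le_tsum _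
  intro k
  induction k with
  | zero =>
    intro n hn
    obtain rfl : n = 0 := by simpa [M] using hn
    simp [dirichlet, hp0]
  | succ k ih =>
    intro n hn
    obtain ⟨s, i, hi, rfl⟩ : ∃ s i, i < M m k ∧ n = s * M m k + i :=
      ⟨n / M m k, n % M m k, Nat.mod_lt _ (M_pos m k), (Nat.div_add_mod' n (M m k)).symm⟩
    have hs : s ≤ m k :=
      Nat.le_of_mul_le_mul_right ((Nat.le_add_right _ i).trans hn.le) (M_pos m k)
    have hmk : (1 : ℝ≥0∞) ≤ (m k : ℝ≥0∞) := by exact_mod_cast NeZero.pos (m k)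
    refine (lintegral_dirichlet_mul_M_add_le m hm hp0 hp1 hi hn.le).trans ?_
    have h1 : ∀ t : ZMod (m k), ‖cyclicDirichlet (m k) s t‖ₑ ^ p ≤ B := by
      intro t
      have h2 : ‖cyclicDirichlet (m k) s t‖ₑ ≤ (m k : ℝ≥0∞) := by
        rw [← ofReal_norm, ← ENNReal.ofReal_natCast]
        exact ENNReal.ofReal_le_ofReal
          ((norm_cyclicDirichlet_le (m k) s t).trans (by exact_mod_cast hs))
      calc ‖cyclicDirichlet (m k) s t‖ₑ ^ p ≤ (m k : ℝ≥0∞) ^ p := by gcongr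
        _ ≤ (m k : ℝ≥0∞) ^ (1 : ℝ) := ENNReal.rpow_le_rpow_of_exponent_le hmk hp1
        _ ≤ B := by
          rw [ENNReal.rpow_one]
          exact_mod_cast hB k
    have h2 : (m k : ℝ≥0∞)⁻¹ * ∑ t : ZMod (m k), ‖cyclicDirichlet (m k) s t‖ₑ ^ p ≤ B := by
      rw [ENNReal.inv_mul_le_iff (Nat.cast_ne_zero.2 (NeZero.ne (m k)))
        (ENNReal.natCast_ne_top _)]
      refine (Finset.sum_le_card_nsmul _ _ _ fun t _ => h1 t).trans_eq ?_
      rw [Finset.card_univ, ZMod.card, nsmul_eq_mul]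
    have h3 : (M m k : ℝ≥0∞) ^ (p - 1) ≤ ((2 : ℝ≥0∞) ^ (p - 1)) ^ k := by
      rw [← ENNReal.rpow_natCast, ← ENNReal.rpow_mul, mul_comm, ENNReal.rpow_mul,
        ENNReal.rpow_natCast]
      rw [← neg_sub 1 p, ENNReal.rpow_neg, ENNReal.rpow_neg, ENNReal.inv_le_inv]
      refine ENNReal.rpow_le_rpow ?_ (by linarith)
      exact_mod_cast two_pow_le_M m hm k
    rw [Finset.sum_range_succ, mul_add, add_comm]
    refine add_le_add (ih i hi) ?_
    rw [mul_comm]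
    gcongr

end Kernel

/-! ### From the kernel bound to the approximation error -/

section Approximation

variable (m : ℕ → ℕ) [∀ j, NeZero (m j)]

theorem hardyNorm_partialSum_sub_le (hm : ∀ j, 2 ≤ m j) {p : ℝ} (hp0 : 0 < p) (hp1 : p ≤ 1)
    {f : ℕ → Group m → ℂ} (hf : Martingale f (filtration m) (haar m)) {k n : ℕ}
    (hkn : M m k < n) (hnk : n ≤ M m (k + 1)) :
    hardyNorm m p (toMartingale m (martingalePartialSum m n f) - f) ≤
      ((M m (k + 1) : ℝ≥0∞) ^ (1 - p) * (∫⁻ x, ‖dirichlet m n x‖ₑ ^ p ∂(haar m)) + 1) ^ (1 / p) *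
        modulus m p k f := by
  set S : ℕ → Group m → ℂ := fun l => martingalePartialSum m l f with hS
  have hfS : ∀ j, f j = S (M m j) := martingale_eq_martingalePartialSum m hm hf
  have hmart : ∀ l j, toMartingale m (S l) j = S (min (M m j) l) := fun l j =>
    partialSum_martingalePartialSum m hm f (M m j) l
  set g : ℕ → Group m → ℂ := f - toMartingale m (S (M m k)) with hg
  have hgk : g (k + 1) = S (M m (k + 1)) - S (M m k) := by
    rw [hg, Pi.sub_apply, hmart, hfS, min_eq_right (M_mono m (Nat.le_succ k))]
  have hdS : ∀ l, l ≤ M m (k + 1) → DependsOn (S l) (Set.Iio (k + 1)) := fun l hl =>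
    dependsOn_martingalePartialSum m hm f hl
  have hMk : M m k ≤ M m (k + 1) := M_mono m (Nat.le_succ k)
  have hdg : DependsOn (g (k + 1)) (Set.Iio (k + 1)) := by
    intro a b hab
    rw [hgk, Pi.sub_apply, Pi.sub_apply, hdS _ le_rfl hab, hdS _ hMk hab]
  have hSn : partialSum m n (g (k + 1)) = S n - S (M m k) := by
    rw [hgk, partialSum_sub m hm hnk (hdS _ le_rfl) (hdS _ hMk)]
    simp only [hS]
    rw [partialSum_martingalePartialSum m hm, partialSum_martingalePartialSum m hm,
      min_eq_left hnk, min_eq_right hkn.le]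
  have hmax : ∀ x, maximal m (toMartingale m (S n) - f) x ≤
      ‖partialSum m n (g (k + 1)) x‖ₑ + maximal m g x := by
    intro x
    refine iSup_le fun j => ?_
    -- Up to level `k` both martingales agree; beyond it the truncation at `n` is complete and
    -- `S_{M_k} f` can be subtracted from both terms.
    rcases le_or_gt j k with hj | hj
    · rw [Pi.sub_apply, hmart, hfS, min_eq_left ((M_mono m hj).trans hkn.le), sub_self]
      simp
    · have h1 : (toMartingale m (S n) - f) j x = partialSum m n (g (k + 1)) x - g j x := by
        rw [hSn, hg]
        simp only [Pi.sub_apply]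
        rw [hmart, hmart, hfS, min_eq_right (hnk.trans (M_mono m hj)),
          min_eq_right (M_mono m hj.le)]
        ring
      rw [h1]
      exact enorm_sub_le.trans
        (add_le_add le_rfl (le_iSup (fun j => ‖g j x‖ₑ) j))
  have hmeas : AEMeasurable (fun x => ‖partialSum m n (g (k + 1)) x‖ₑ ^ p) (haar m) := by
    rw [hSn]
    exact ((integrable_dependsOn m (hdS n hnk)).sub
      (integrable_dependsOn m (hdS _ hMk))).aestronglyMeasurable.enorm.pow_const p
  have hint : ∫⁻ x, maximal m (toMartingale m (S n) - f) x ^ p ∂(haar m) ≤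
      ((M m (k + 1) : ℝ≥0∞) ^ (1 - p) * (∫⁻ x, ‖dirichlet m n x‖ₑ ^ p ∂(haar m)) + 1) *
        ∫⁻ x, maximal m g x ^ p ∂(haar m) := by
    calc ∫⁻ x, maximal m (toMartingale m (S n) - f) x ^ p ∂(haar m)
        ≤ ∫⁻ x, (‖partialSum m n (g (k + 1)) x‖ₑ ^ p + maximal m g x ^ p) ∂(haar m) :=
          lintegral_mono fun x => (ENNReal.rpow_le_rpow (hmax x) hp0.le).trans
            (ENNReal.rpow_add_le_add_rpow _ _ hp0.le hp1)
      _ = ∫⁻ x, ‖partialSum m n (g (k + 1)) x‖ₑ ^ p ∂(haar m) +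
            ∫⁻ x, maximal m g x ^ p ∂(haar m) := lintegral_add_left' hmeas _
      _ ≤ _ := by
        rw [add_mul, one_mul]
        gcongr
        refine (lintegral_partialSum_rpow_le m hm hp0 hp1 hnk hdg).trans ?_
        gcongr with x
        exact le_iSup (fun j => ‖g j x‖ₑ) (k + 1)
  calc hardyNorm m p (toMartingale m (S n) - f)
      ≤ (((M m (k + 1) : ℝ≥0∞) ^ (1 - p) * (∫⁻ x, ‖dirichlet m n x‖ₑ ^ p ∂(haar m)) + 1) *
        ∫⁻ x, maximal m g x ^ p ∂(haar m)) ^ (1 / p) :=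
        ENNReal.rpow_le_rpow hint (by positivity)
    _ = _ := ENNReal.mul_rpow_of_nonneg _ _ (by positivity)

end Approximation

end Vilenkin

/-! ### Choice of the constants -/

theorem theorem2 (p : ℝ) (hp0 : 0 < p) (hp1 : p ≤ 1) (B : ℕ) :
    ∃ c : ℝ, 0 < c ∧
      ∀ (m : ℕ → ℕ) [∀ j, NeZero (m j)], (∀ j, 2 ≤ m j) → (p < 1 → ∀ j, m j ≤ B) →
        ∀ f : ℕ → Vilenkin.Group m → ℂ, Vilenkin.MemHardy m p f →
          ∀ k n : ℕ, Vilenkin.M m k < n → n ≤ Vilenkin.M m (k + 1) →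
            Vilenkin.hardyNorm m p
                (Vilenkin.toMartingale m (Vilenkin.martingalePartialSum m n f) - f) ≤
              ENNReal.ofReal (c * (n : ℝ) ^ (1 / p - 1) * Real.log n ^ ⌊p⌋₊) *
                Vilenkin.modulus m p k f := by
  rcases hp1.eq_or_lt with rfl | hlt
  -- For `n ≥ 2` one has `n + 1 ≤ n ^ 2` and `1 ≤ 2 log n`, so `6 log (n + 1) + 1 ≤ 14 log n`.
  · refine ⟨14, by norm_num, fun m _ hm _ f hf k n hkn hnk => ?_⟩
    refine (Vilenkin.hardyNorm_partialSum_sub_le m hm hp0 hp1 hf.1 hkn hnk).trans ?_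
    gcongr
    have hn : 2 ≤ n := (Nat.succ_le_of_lt (Vilenkin.M_pos m k)).trans_lt hkn
    have hn' : (2 : ℝ) ≤ n := by exact_mod_cast hn
    have h1 : Real.log 2 ≤ Real.log n := Real.log_le_log two_pos hn'
    have h2 := Real.log_two_gt_d9
    have h3 : Real.log (n + 1) ≤ 2 * Real.log n := by
      rw [← Real.log_rpow (by linarith)]
      refine Real.log_le_log (by linarith) ?_
      norm_num
      nlinarith
    have h4 : 0 ≤ Real.log ((n : ℝ) + 1) := Real.log_nonneg (by linarith)
    simp only [sub_self, ENNReal.rpow_zero, one_mul, ENNReal.rpow_one, div_one, Real.rpow_zero,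
      mul_one, Nat.floor_one, pow_one]
    refine (add_le_add (Vilenkin.lintegral_enorm_dirichlet_le m hm n) le_rfl).trans ?_
    rw [← ENNReal.ofReal_one, ← ENNReal.ofReal_add (by positivity) zero_le_one]
    exact ENNReal.ofReal_le_ofReal (by linarith)
  · have hp : 0 < 1 - p := sub_pos.2 hlt
    set A : ℝ≥0∞ := B * (1 - 2 ^ (p - 1))⁻¹ with hA
    have h2p : (2 : ℝ≥0∞) ^ (p - 1) < 1 :=
      ENNReal.rpow_lt_one_of_one_lt_of_neg ENNReal.one_lt_two (by linarith)
    have hAt : A ≠ ∞ := ENNReal.mul_ne_top (ENNReal.natCast_ne_top _)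
      (ENNReal.inv_ne_top.2 (tsub_pos_of_lt h2p).ne')
    -- The first term comes from `M_{k+1} ≤ B n`. The summand `1` absorbs the contribution of `g^*`,
    -- as `1 ≤ n ^ (1 - p)`, and keeps the constant positive for every `B`.
    set K : ℝ≥0∞ := (B : ℝ≥0∞) ^ (1 - p) * A + 1 with hK
    have hKt : K ≠ ∞ := ENNReal.add_ne_top.2 ⟨ENNReal.mul_ne_top
      (ENNReal.rpow_ne_top_of_nonneg hp.le (ENNReal.natCast_ne_top _)) hAt, ENNReal.one_ne_top⟩
    have hK0 : K ≠ 0 := by simp [hK]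
    have hKpt : K ^ (1 / p) ≠ ∞ := ENNReal.rpow_ne_top_of_nonneg (by positivity) hKt
    have hKp0 : K ^ (1 / p) ≠ 0 := by simp [ENNReal.rpow_eq_zero_iff, hK0, hKt]
    refine ⟨(K ^ (1 / p)).toReal, ENNReal.toReal_pos hKp0 hKpt,
      fun m _ hm hB f hf k n hkn hnk => ?_⟩
    refine (Vilenkin.hardyNorm_partialSum_sub_le m hm hp0 hp1 hf.1 hkn hnk).trans ?_
    gcongr
    have hn : 1 ≤ n := (Nat.zero_le _).trans_lt hkn
    have hn0 : (0 : ℝ) < n := by exact_mod_cast hn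
    have hMn : Vilenkin.M m (k + 1) ≤ B * n := Nat.mul_le_mul (hB hlt k) hkn.le
    have h1 : (Vilenkin.M m (k + 1) : ℝ≥0∞) ≤ (B : ℝ≥0∞) * n := by exact_mod_cast hMn
    have h2 : (1 : ℝ≥0∞) ≤ (n : ℝ≥0∞) ^ (1 - p) :=
      ENNReal.one_le_rpow (by exact_mod_cast hn) hp
    have h3 : (Vilenkin.M m (k + 1) : ℝ≥0∞) ^ (1 - p) *
        (∫⁻ x, ‖Vilenkin.dirichlet m n x‖ₑ ^ p ∂(Vilenkin.haar m)) + 1 ≤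
          K * (n : ℝ≥0∞) ^ (1 - p) := by
      calc _ ≤ ((B : ℝ≥0∞) * n) ^ (1 - p) * A + (n : ℝ≥0∞) ^ (1 - p) := by
            gcongr
            exact Vilenkin.lintegral_enorm_dirichlet_rpow_le m hm hp0 hp1 (hB hlt) n
        _ = _ := by
          rw [ENNReal.mul_rpow_of_nonneg _ _ hp.le, hK]
          ring
    have h4 : (1 - p) * (1 / p) = 1 / p - 1 := by
      field_simp
    rw [Nat.floor_eq_zero.2 hlt, pow_zero, mul_one, ENNReal.ofReal_mul ENNReal.toReal_nonneg,
      ENNReal.ofReal_toReal hKpt, ← ENNReal.ofReal_rpow_of_pos hn0, ENNReal.ofReal_natCast, ← h4,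
      ENNReal.rpow_mul, ← ENNReal.mul_rpow_of_nonneg _ _ (by positivity)]
    exact ENNReal.rpow_le_rpow h3 (by positivity)
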